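/- Let $L$ be a finite set of labels. An $L$-digraph is a directed graph whose edges carry labels from $L$ such that at every vertex the outgoing edges have pairwise distinct labels and the incoming edges have pairwise distinct labels; connectedness, regularity, girth and distances refer to the underlying undirected simple graph (an acyclic graph has infinite girth). For a vertex $u$ of an $L$-digraph $\mathcal H$ whose vertices are linearly ordered by $<$, let the $r$-neighbourhood $\tau(\mathcal H,<,u)$ be the restriction of $\mathcal H$ (with its edge directions and labels) and of $<$ to the set of vertices at distance at most $r$ from $u$, rooted at $u$. A finite ordered $L$-digraph $(\mathcal H,<)$ is $(\alpha,r)$-homogeneous with homogeneity type $\tau^*$ if there is a set $U\subseteq V(\mathcal H)$ with $|U|\ge\alpha|V(\mathcal H)|$ such that $\tau(\mathcal H,<,u)\cong\tau^*$ for all $u\in U$, where isomorphisms preserve the root, the linear order, the directed edges and their labels. Theorem. Let $k,r\in\mathbb N$. There is a rooted, linearly ordered $L$-digraph $\tau^*$ with $|L|=k$, such that for every $\varepsilon>0$ there exists a finite, connected, $2k$-regular, linearly ordered $L$-digraph $(\mathcal H_\varepsilon,<_\varepsilon)$ of girth larger than $2r+1$ that is $(1-\varepsilon,r)$-homogeneous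 with homogeneity type $\tau^*$. In particular, the homogeneity type $\tau^*$ does not depend on $\varepsilon$. -/

import Mathlib

/-- A properly `L`-edge-labelled directed graph on the vertex set `V`.
`Edge u a v` says that `(u, v)` is a directed edge and that its label is `a`. Every edge has one
label, distinct outgoing edges of a vertex have distinct labels, and so have distinct incoming
edges of a vertex. -/
structure LDigraph (L : Type*) (V : Type*) where
  Edge : V → L → V → Prop
  label_unique : ∀ {u v : V} {a b : L}, Edge u a v → Edge u b v → a = b
  out_proper : ∀ {u v w : V} {a : L}, Edge u a v → Edge u a w → v = w
  in_proper : ∀ {u v w : V} {a : L}, Edge u a w → Edge v a w → u = v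

/-- A rooted, linearly ordered, properly `L`-edge-labelled directed graph. -/
structure RootedOrderedLDigraph (L : Type*) where
  Carrier : Type
  order : LinearOrder Carrier
  graph : LDigraph L Carrier
  root : Carrier

attribute [instance] RootedOrderedLDigraph.order

/-- Isomorphism of rooted ordered `L`-digraphs: a bijection of the vertices that preserves the
linear order, the root, and the directed edges together with their labels (in both directions). -/
def RootedOrderedLDigraph.Isomorphic {L : Type*} (A B : RootedOrderedLDigraph L) : Prop :=
  ∃ f : A.Carrier ≃o B.Carrier, f A.root = B.root ∧
    ∀ (u v : A.Carrier) (a : L), A.graph.Edge u a v ↔ B.graph.Edge (f u) a (f v)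

namespace LDigraph

/-- The underlying undirected simple graph. -/
def toSimpleGraph {L V : Type*} (G : LDigraph L V) : SimpleGraph V :=
  SimpleGraph.fromRel fun u v => ∃ a, G.Edge u a v

/-- The restriction of an `L`-digraph to a set of vertices. -/
def induce {L V : Type*} (G : LDigraph L V) (s : Set V) : LDigraph L s where
  Edge u a v := G.Edge u.1 a v.1
  label_unique h h' := G.label_unique h h'
  out_proper h h' := Subtype.ext (G.out_proper h h')
  in_proper h h' := Subtype.ext (G.in_proper h h')

/-- The set of vertices at distance at most `r` from `u` in the underlying undirected graph. -/
def ball {L V : Type*} (G : LDigraph L V) (r : ℕ) (u : V) : Set V :=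
  {v | G.toSimpleGraph.edist u v ≤ r}

theorem self_mem_ball {L V : Type*} (G : LDigraph L V) (r : ℕ) (u : V) : u ∈ G.ball r u := by
  simp [ball]

/-- The radius-`r` neighbourhood of `u` in the ordered `L`-digraph `G`: the restriction of the
digraph, its labels and the linear order to the ball of radius `r` around `u`, rooted at `u`. -/
def neighbourhood {L : Type*} {V : Type} [LinearOrder V] (G : LDigraph L V) (r : ℕ) (u : V) :
    RootedOrderedLDigraph L where
  Carrier := G.ball r u
  order := inferInstance
  graph := G.induce (G.ball r u)
  root := ⟨u, G.self_mem_ball r u⟩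

/-- The finite ordered `L`-digraph `G` is `(α, r)`-homogeneous with homogeneity type `τ`: at least
`α * |V|` of the vertices have a radius-`r` neighbourhood of isomorphism type `τ`. -/
def IsHomogeneous {L : Type*} {V : Type} [Fintype V] [LinearOrder V] (G : LDigraph L V)
    (α : ℝ) (r : ℕ) (τ : RootedOrderedLDigraph L) : Prop :=
  ∃ U : Finset V, α * (Fintype.card V : ℝ) ≤ (U.card : ℝ) ∧
    ∀ u ∈ U, (G.neighbourhood r u).Isomorphic τ

end LDigraph

/-! Let the free group on `k` generators act by left multiplication on noncommutative power series
over `ZMod m` with constant term `1`, truncated at degree `2r+2`, the generator `a` acting as `1 + X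
a` (Magnus). If `g` and `h` first differ in their integral expansions at the word `w`, then `g • f`
and `h • f` also agree before `w`, and at `w` they differ by exactly the same integer mod `m`,
whatever `f` is (`smul_sub_smul`).

Two consequences follow. Short elements have distinct truncated expansions
(`exists_expansion_ne_zero`), so for `m` beyond a bound `B` on coefficient differences they act
freely, and Schreier graphs have large girth and locally look like the Cayley graph. Moreover,
ordering series lexicographically by residues makes `g • f < h • f` agree with the lexicographic
order of the integral expansions, unless a residue wraps around modulo `m`. That order on the ball
of the free group depends on neither `m` nor `ε`; it gives the type.

Wrap-around is possible only if some `g • f`, with `g` in the ball, has a coefficient among the top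
`B` residues, a proportion `O(1/m)` of all `f` by the union bound. Some orbit does at least as well
as the average, and an orbit is connected. -/

namespace Magnus

open FreeGroup (of mk IsReduced)

variable {α : Type*} {R : Type*} [CommRing R]

/-! ### Convolution of noncommutative power series -/

/-- The product of noncommutative power series. -/
def conv : (List α → R) → (List α → R) → List α → R
  | A, f, [] => A [] * f []
  | A, f, b :: w => A [] * f (b :: w) + conv (fun v => A (b :: v)) f w

theorem conv_add (A B f : List α → R) (w : List α) :
    conv (fun v => A v + B v) f w = conv A f w + conv B f w := by
  induction w generalizing A B with
  | nil => simp [conv, add_mul]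
  | cons b w ih => simp only [conv, ih]; ring

theorem conv_sub (A B f : List α → R) (w : List α) :
    conv (fun v => A v - B v) f w = conv A f w - conv B f w := by
  induction w generalizing A B with
  | nil => simp [conv, sub_mul]
  | cons b w ih => simp only [conv, ih]; ring

theorem conv_eq_of_forall_length_lt (A f : List α → R) (w : List α)
    (h : ∀ v : List α, v.length < w.length → A v = 0) : conv A f w = A w * f [] := by
  induction w generalizing A with
  | nil => rfl
  | cons b w ih =>
    rw [conv, h [] (by simp), ih _ (fun v hv => h _ (by simpa using hv))]
    simp

/-- The power series `1`. -/
def one (α : Type*) (R : Type*) [CommRing R] : List α → R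
  | [] => 1
  | _ :: _ => 0

theorem conv_one (f : List α → R) : conv (one α R) f = f := by
  funext w
  cases w with
  | nil => simp [conv, one]
  | cons b w =>
    rw [conv, conv_eq_of_forall_length_lt (fun v => one α R (b :: v)) _ _ (fun v _ => rfl)]
    simp [one]

variable [DecidableEq α]

/-! ### The Magnus representation -/

/-- Left multiplication by `1 + X a` on noncommutative power series, given by their
coefficients. -/
def mulGen (a : α) (f : List α → R) : List α → R
  | [] => f []
  | b :: w => f (b :: w) + if b = a then f w else 0

/-- Left multiplication by `(1 + X a)⁻¹` on noncommutative power series. -/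
def mulGenInv (a : α) (f : List α → R) : List α → R
  | [] => f []
  | b :: w => f (b :: w) - if b = a then mulGenInv a f w else 0

/-- Left multiplication by `1 + X a` as a permutation of the noncommutative power series. -/
def genPerm (R : Type*) [CommRing R] (a : α) : Equiv.Perm (List α → R) where
  toFun := mulGen a
  invFun := mulGenInv a
  left_inv f := by
    funext w
    induction w with
    | nil => rfl
    | cons b w ih => by_cases h : b = a <;> simp [mulGenInv, mulGen, h, ih]
  right_inv f := by
    funext w
    cases w with
    | nil => rfl
    | cons b w => by_cases h : b = a <;> simp [mulGenInv, mulGen, h]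

/-- The Magnus representation of the free group on noncommutative power series. -/
def rep (R : Type*) [CommRing R] : FreeGroup α →* Equiv.Perm (List α → R) :=
  FreeGroup.lift (genPerm R)

@[simp] theorem rep_of (a : α) : rep R (of a) = genPerm R a := by simp [rep]

theorem genPerm_apply (a : α) (f : List α → R) : genPerm R a f = mulGen a f := rfl

theorem genPerm_symm_apply (a : α) (f : List α → R) : (genPerm R a)⁻¹ f = mulGenInv a f := rfl

@[simp] theorem rep_apply_nil (g : FreeGroup α) (f : List α → R) : rep R g f [] = f [] := by
  induction g using FreeGroup.induction_on generalizing f with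
  | C1 => simp
  | of a => simp [genPerm_apply, mulGen]
  | inv_of a _ => simp [genPerm_symm_apply, mulGenInv]
  | mul x y hx hy => simp [hx, hy]

/-- Multiplication by `(1 + X a)^±1` never lowers degree; this lets the action descend to truncated
series. -/
theorem rep_congr (g : FreeGroup α) (d : ℕ) (f f' : List α → R)
    (h : ∀ w : List α, w.length ≤ d → f w = f' w) (w : List α) (hw : w.length ≤ d) :
    rep R g f w = rep R g f' w := by
  induction g using FreeGroup.induction_on generalizing f f' w with
  | C1 => simpa using h w hw
  | of a =>
    cases w with
    | nil => simpa [genPerm_apply, mulGen] using h [] hw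
    | cons b w =>
      have h1 := h w (by simp at hw; omega)
      simp [genPerm_apply, mulGen, h _ hw, h1]
  | inv_of a _ =>
    simp only [map_inv, rep_of, genPerm_symm_apply]
    induction w with
    | nil => simpa [mulGenInv] using h [] hw
    | cons b w ih =>
      have h1 := ih (by simp at hw; omega)
      simp [mulGenInv, h _ hw, h1]
  | mul x y hx hy =>
    simp only [map_mul, Equiv.Perm.mul_apply]
    exact hx _ _ (fun v hv => hy _ _ h v hv) w hw

theorem conv_mulGen (a : α) (A f : List α → R) :
    conv (mulGen a A) f = mulGen a (conv A f) := by
  funext w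
  cases w with
  | nil => rfl
  | cons b w =>
    by_cases h : b = a
    · simp only [conv, mulGen, h, if_true, conv_add]; ring
    · simp [conv, mulGen, h]

theorem cast_mulGen (a : α) (A : List α → ℤ) :
    (fun v => ((mulGen a A v : ℤ) : R)) = mulGen a (fun v => (A v : R)) := by
  funext w
  cases w with
  | nil => rfl
  | cons b w => simp [mulGen]

/-- Left multiplication by generators commutes with right multiplication by `f`. With `A = 1` it
turns `rep` into convolution with the expansion. -/
theorem conv_cast_rep (g : FreeGroup α) (A : List α → ℤ) (f : List α → R) :
    conv (fun v => ((rep ℤ g A v : ℤ) : R)) f = rep R g (conv (fun v => (A v : R)) f) := by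
  induction g using FreeGroup.induction_on generalizing A with
  | C1 => simp
  | of a => simp only [rep_of, genPerm_apply, cast_mulGen, conv_mulGen]
  | inv_of a ih =>
    have := ih (rep ℤ (of a)⁻¹ A)
    rw [← Equiv.Perm.mul_apply, ← map_mul, mul_inv_cancel, map_one] at this
    rw [map_inv (rep R), Equiv.Perm.eq_inv_iff_eq, ← this]
    rfl
  | mul x y hx hy =>
    simp only [map_mul, Equiv.Perm.mul_apply, hx, hy]

/-- The integral power series representing an element of the free group. -/
def expansion (g : FreeGroup α) : List α → ℤ := rep ℤ g (one α ℤ)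

theorem expansion_mul (g h : FreeGroup α) : expansion (g * h) = rep ℤ g (expansion h) := by
  rw [expansion, expansion, ← Equiv.Perm.mul_apply, ← map_mul]

theorem expansion_mk_cons (p : α × Bool) (l : List (α × Bool)) :
    expansion (mk (p :: l)) = rep ℤ (mk [p]) (expansion (mk l)) := by
  rw [← expansion_mul, FreeGroup.mul_mk, List.singleton_append]

theorem rep_eq_conv (g : FreeGroup α) (f : List α → R) :
    rep R g f = conv (fun v => (expansion g v : R)) f := by
  rw [expansion, conv_cast_rep]
  congr 1
  have : (fun v => ((one α ℤ v : ℤ) : R)) = one α R := by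
    funext v; cases v <;> simp [one]
  rw [this, conv_one]

/-- The difference of the expansions has no terms shorter than `w`, so at `w` only its own
coefficient times the constant term of `f` survives. -/
theorem rep_sub_rep (g h : FreeGroup α) (f : List α → R) (w : List α)
    (H : ∀ v : List α, v.length < w.length → expansion g v = expansion h v) :
    rep R g f w - rep R h f w = ((expansion g w - expansion h w : ℤ) : R) * f [] := by
  rw [rep_eq_conv, rep_eq_conv, ← conv_sub, conv_eq_of_forall_length_lt]
  · push_cast; ring
  · intro v hv; simp [H v hv]

/-! ### Faithfulness of the expansion, with a degree bound -/

/-- In `(1 + X a)⁻¹ = 1 - X a + X a ^ 2 - ...` the terms of degree at least two begin with a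
repeated letter, so they do not contribute at words without adjacent repetitions. -/
theorem rep_letter_cons (a : α) (b : Bool) (f : List α → ℤ) (x : α) (w : List α)
    (h : List.IsChain (· ≠ ·) (x :: w)) :
    rep ℤ (mk [(a, b)]) f (x :: w) =
      f (x :: w) + if x = a then (if b then 1 else -1) * f w else 0 := by
  cases b with
  | true =>
    change rep ℤ (of a) f (x :: w) = _
    simp [genPerm_apply, mulGen]
  | false =>
    change rep ℤ (of a)⁻¹ f (x :: w) = _
    rw [map_inv, rep_of, genPerm_symm_apply]
    by_cases hx : x = a
    · cases w with
      | nil => simp [mulGenInv, hx, sub_eq_add_neg]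
      | cons y w =>
        have : y ≠ a := by
          rw [List.isChain_cons_cons] at h
          exact fun hy => h.1 (hx.trans hy.symm)
        simp [mulGenInv, hx, this, sub_eq_add_neg]
    · simp [mulGenInv, hx]

/-- Group the reduced word into syllables `a₁^e₁ ⋯ aₛ^eₛ`. Then `a :: w` lists the syllable letters,
`n = |e₁|`, and `c = e₂ ⋯ eₛ`. The coefficient at `a :: w` is the product of all exponents, hence
nonzero. The two vanishing clauses carry the induction. -/
theorem exists_expansion_mk_cons (l : List (α × Bool)) (a : α) (b : Bool)
    (hl : IsReduced ((a, b) :: l)) :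
    ∃ (w : List α) (c n : ℤ), List.IsChain (· ≠ ·) (a :: w) ∧ w.length ≤ l.length ∧ 1 ≤ n ∧
      c ≠ 0 ∧ expansion (mk ((a, b) :: l)) w = c ∧
      expansion (mk ((a, b) :: l)) (a :: w) = (if b then 1 else -1) * n * c ∧
      (∀ v : List α, List.IsChain (· ≠ ·) v → w.length + 1 < v.length →
        expansion (mk ((a, b) :: l)) v = 0) ∧
      ∀ v : List α, List.IsChain (· ≠ ·) (a :: v) → w.length + 1 ≤ v.length →
        expansion (mk ((a, b) :: l)) v = 0 := by
  induction l generalizing a b with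
  | nil =>
    have h1 : expansion (mk ([] : List (α × Bool))) = one α ℤ := by
      rw [← FreeGroup.one_eq_mk, expansion, map_one]; rfl
    refine ⟨[], 1, 1, by simp, le_rfl, le_rfl, one_ne_zero, ?_, ?_, ?_, ?_⟩
    · simp [expansion, one]
    · rw [expansion_mk_cons, h1, rep_letter_cons _ _ _ _ _ (by simp)]; simp [one]
    · intro v hv hlen
      obtain _ | ⟨x, _ | ⟨y, v⟩⟩ := v
      · simp at hlen
      · simp at hlen
      · rw [expansion_mk_cons, h1, rep_letter_cons _ _ _ _ _ hv]; simp [one]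
    · intro v hv hlen
      cases v with
      | nil => simp at hlen
      | cons x v =>
        rw [List.isChain_cons_cons] at hv
        rw [expansion_mk_cons, h1, rep_letter_cons _ _ _ _ _ hv.2, if_neg hv.1.symm]; simp [one]
  | cons p l ih =>
    obtain ⟨a', b'⟩ := p
    rw [FreeGroup.isReduced_cons_cons] at hl
    obtain ⟨w, c, n, hch, hlen, hn, hc, hw, haw, hv, hv'⟩ := ih a' b' hl.2
    by_cases haa : a = a'
    · subst haa
      obtain rfl : b = b' := hl.1 rfl
      -- The first syllable grows; being reduced forces equal signs, so its exponent cannot cancel.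
      refine ⟨w, c, n + 1, hch, by simp; omega, by omega, hc, ?_, ?_, ?_, ?_⟩
      · rw [expansion_mk_cons]
        cases w with
        | nil => rw [rep_apply_nil]; exact hw
        | cons x w =>
          rw [List.isChain_cons_cons] at hch
          rw [rep_letter_cons _ _ _ _ _ hch.2, if_neg hch.1.symm, hw, add_zero]
      · rw [expansion_mk_cons, rep_letter_cons _ _ _ _ _ hch, haw, hw]
        cases b <;> simp <;> ring
      · intro v hvc hvl
        rw [expansion_mk_cons]
        cases v with
        | nil => simp at hvl
        | cons x v =>
          rw [rep_letter_cons _ _ _ _ _ hvc, hv _ hvc hvl, zero_add]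
          by_cases hx : x = a
          · subst hx
            rw [hv' _ hvc (by simpa using Nat.lt_succ_iff.1 hvl)]; simp
          · simp [hx]
      · intro v hvc hvl
        rw [expansion_mk_cons]
        cases v with
        | nil => simp at hvl
        | cons x v =>
          have hvc' := List.isChain_cons_cons.1 hvc
          rw [rep_letter_cons _ _ _ _ _ hvc'.2, if_neg hvc'.1.symm, hv' _ hvc hvl, add_zero]
    -- A new syllable starts: the old leading word and coefficient become the tail.
    · refine ⟨a' :: w, (if b' then 1 else -1) * n * c, 1, ?_, by simp; omega, le_rfl, ?_, ?_, ?_, ?_, ?_⟩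
      · exact List.isChain_cons_cons.2 ⟨haa, hch⟩
      · refine mul_ne_zero (mul_ne_zero ?_ (by omega)) hc
        cases b' <;> simp
      · rw [expansion_mk_cons, rep_letter_cons _ _ _ _ _ hch, if_neg (Ne.symm haa), haw, add_zero]
      · rw [expansion_mk_cons, rep_letter_cons _ _ _ _ _ (List.isChain_cons_cons.2 ⟨haa, hch⟩), if_pos rfl, haw,
          hv _ (List.isChain_cons_cons.2 ⟨haa, hch⟩) (by simp)]
        ring
      · intro v hvc hvl
        rw [expansion_mk_cons]
        cases v with
        | nil => simp at hvl
        | cons x v =>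
          rw [List.length_cons, List.length_cons] at hvl
          rw [rep_letter_cons _ _ _ _ _ hvc, hv _ hvc (by simp; omega),
            hv v hvc.tail (by omega)]
          simp
      · intro v hvc hvl
        rw [expansion_mk_cons]
        cases v with
        | nil => simp at hvl
        | cons x v =>
          rw [List.length_cons] at hvl
          have hvc' := List.isChain_cons_cons.1 hvc
          rw [rep_letter_cons _ _ _ _ _ hvc'.2, if_neg hvc'.1.symm, hv _ hvc'.2 (by omega),
            add_zero]

theorem exists_expansion_ne_zero (g : FreeGroup α) (hg : g ≠ 1) :
    ∃ w : List α, w ≠ [] ∧ w.length ≤ g.norm ∧ expansion g w ≠ 0 := by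
  have hr := FreeGroup.isReduced_toWord (x := g)
  obtain hl | ⟨⟨a, b⟩, l, hl⟩ : g.toWord = [] ∨ ∃ p l, g.toWord = p :: l := by
    cases g.toWord <;> simp
  · exact absurd (FreeGroup.toWord_eq_nil_iff.1 hl) hg
  · rw [hl] at hr
    obtain ⟨w, c, n, _, hlen, hn, hc, _, haw, _, _⟩ := exists_expansion_mk_cons l a b hr
    rw [← hl, FreeGroup.mk_toWord] at haw
    refine ⟨a :: w, by simp, by simp [FreeGroup.norm, hl, hlen], ?_⟩
    rw [haw]
    refine mul_ne_zero (mul_ne_zero ?_ (by omega)) hc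
    cases b <;> simp

end Magnus

/-! ### Schreier graphs of locally free actions -/

namespace Schreier

open FreeGroup (of mk IsReduced)

theorem inv_letter {α : Type*} (a : α) (b : Bool) : (mk [(a, b)])⁻¹ = mk [(a, !b)] := by
  simp [FreeGroup.inv_mk, FreeGroup.invRev]

theorem mk_cons {α : Type*} (p : α × Bool) (l : List (α × Bool)) : mk (p :: l) = mk [p] * mk l := by
  rw [FreeGroup.mul_mk, List.singleton_append]

variable {α : Type*} [DecidableEq α] {X : Type} [MulAction (FreeGroup α) X]

/-- Nontrivial elements of norm at most `N` act without fixed points. -/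
def FreeUpTo (α : Type*) [DecidableEq α] (X : Type) [MulAction (FreeGroup α) X] (N : ℕ) : Prop :=
  ∀ g : FreeGroup α, g.norm ≤ N → ∀ x : X, g • x = x → g = 1

theorem FreeUpTo.mono {N M : ℕ} (h : FreeUpTo α X N) (hM : M ≤ N) : FreeUpTo α X M :=
  fun g hg => h g (hg.trans hM)

theorem FreeUpTo.smul_left_cancel {N : ℕ} (hN : FreeUpTo α X N) {g h : FreeGroup α}
    (hgh : g.norm + h.norm ≤ N) {x : X} (he : g • x = h • x) : g = h := by
  have : h⁻¹ * g = 1 := by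
    refine hN _ ((FreeGroup.norm_mul_le _ _).trans ?_) x ?_
    · rw [FreeGroup.norm_inv_eq]; omega
    · rw [mul_smul, he, inv_smul_smul]
  exact (inv_mul_eq_one.1 this).symm

/-- The digraph of an action of the free group: the edge with label `a` at `x` goes to
`a • x`. -/
def digraph (h : FreeUpTo α X 2) : LDigraph α X where
  Edge x a y := of a • x = y
  label_unique h1 h2 := FreeGroup.of_injective (h.smul_left_cancel (by simp) (h1.trans h2.symm))
  out_proper h1 h2 := h1.symm.trans h2
  in_proper h1 h2 := smul_left_cancel _ (h1.trans h2.symm)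

theorem norm_letter (p : α × Bool) : (mk [p]).norm = 1 := rfl

theorem letter_ne_one (p : α × Bool) : mk [p] ≠ 1 := by
  intro h
  have := FreeGroup.norm_eq_zero.2 h
  rw [norm_letter] at this
  omega

theorem letter_injective : Function.Injective fun p : α × Bool => mk [p] := by
  intro p q h
  simpa [FreeGroup.toWord_mk, FreeGroup.reduce_singleton] using congrArg FreeGroup.toWord h

theorem digraph_adj (h : FreeUpTo α X 2) (x y : X) :
    (digraph h).toSimpleGraph.Adj x y ↔ ∃ p : α × Bool, mk [p] • x = y := by
  rw [LDigraph.toSimpleGraph, SimpleGraph.fromRel_adj]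
  constructor
  · rintro ⟨-, ⟨a, ha⟩ | ⟨a, ha⟩⟩
    · exact ⟨(a, true), ha⟩
    · refine ⟨(a, false), ?_⟩
      have ha : mk [(a, true)] • y = x := ha
      rw [← ha, show mk [(a, false)] = (mk [(a, true)])⁻¹ from (inv_letter a true).symm,
        inv_smul_smul]
  · rintro ⟨⟨a, b⟩, hp⟩
    refine ⟨fun hxy => ?_, ?_⟩
    · subst hxy
      exact letter_ne_one _ (h _ (by rw [norm_letter]; norm_num) _ hp)
    · cases b with
      | true => exact Or.inl ⟨a, hp⟩
      | false =>
        refine Or.inr ⟨a, ?_⟩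
        change mk [(a, true)] • y = x
        rw [← hp, show mk [(a, false)] = (mk [(a, true)])⁻¹ from (inv_letter a true).symm,
          smul_inv_smul]

theorem exists_walk_smul (h : FreeUpTo α X 2) (l : List (α × Bool)) (x : X) :
    ∃ w : (digraph h).toSimpleGraph.Walk x (mk l • x), w.length = l.length := by
  induction l with
  | nil => exact ⟨SimpleGraph.Walk.nil.copy rfl (one_smul _ x).symm, by simp⟩
  | cons p l ih =>
    obtain ⟨w, hw⟩ := ih
    have hadj : (digraph h).toSimpleGraph.Adj (mk l • x) (mk (p :: l) • x) :=
      (digraph_adj h _ _).2 ⟨p, by rw [mk_cons p l, mul_smul]⟩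
    exact ⟨w.concat hadj, by simp [hw]⟩

theorem exists_smul_of_walk (h : FreeUpTo α X 2) {x y : X}
    (w : (digraph h).toSimpleGraph.Walk x y) :
    ∃ g : FreeGroup α, g.norm ≤ w.length ∧ g • x = y := by
  induction w with
  | nil => exact ⟨1, by simp, one_smul _ _⟩
  | cons hadj w ih =>
    obtain ⟨g, hg, hgy⟩ := ih
    obtain ⟨p, hp⟩ := (digraph_adj h _ _).1 hadj
    refine ⟨g * mk [p], (FreeGroup.norm_mul_le _ _).trans ?_, ?_⟩
    · rw [norm_letter, SimpleGraph.Walk.length_cons]; omega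
    · rw [mul_smul, hp, hgy]

theorem exists_walk_length_eq_norm (h : FreeUpTo α X 2) (g : FreeGroup α) (x : X) :
    ∃ w : (digraph h).toSimpleGraph.Walk x (g • x), w.length = g.norm := by
  have := exists_walk_smul h g.toWord x
  rwa [FreeGroup.mk_toWord] at this

theorem mem_ball_digraph (h : FreeUpTo α X 2) (r : ℕ) (x y : X) :
    y ∈ (digraph h).ball r x ↔ ∃ g : FreeGroup α, g.norm ≤ r ∧ g • x = y := by
  constructor
  · intro hy
    have hy : (digraph h).toSimpleGraph.edist x y ≤ r := hy
    obtain ⟨w, hw⟩ := SimpleGraph.exists_walk_of_edist_ne_top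
      (ne_top_of_le_ne_top (ENat.natCast_ne_top r) hy)
    obtain ⟨g, hg, hgy⟩ := exists_smul_of_walk h w
    rw [← hw] at hy
    exact ⟨g, hg.trans (by exact_mod_cast hy), hgy⟩
  · rintro ⟨g, hg, rfl⟩
    obtain ⟨w, hw⟩ := exists_walk_length_eq_norm h g x
    exact (SimpleGraph.edist_le w).trans (by exact_mod_cast hw.trans_le hg)

theorem digraph_connected (h : FreeUpTo α X 2) [MulAction.IsPretransitive (FreeGroup α) X]
    [Nonempty X] : (digraph h).toSimpleGraph.Connected := by
  refine { preconnected := fun x y => ?_, nonempty := inferInstance }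
  obtain ⟨g, rfl⟩ := MulAction.exists_smul_eq (FreeGroup α) x y
  obtain ⟨w, -⟩ := exists_walk_length_eq_norm h g x
  exact ⟨w⟩

theorem card_neighborSet_digraph (h : FreeUpTo α X 2) (x : X) :
    Nat.card ((digraph h).toSimpleGraph.neighborSet x) = Nat.card (α × Bool) := by
  symm
  refine Nat.card_congr (Equiv.ofBijective (fun p => ⟨mk [p] • x, ?_⟩) ⟨?_, ?_⟩)
  · exact (digraph_adj h _ _).2 ⟨p, rfl⟩
  · intro p q hpq
    exact letter_injective (h.smul_left_cancel (by simp [norm_letter]) (Subtype.ext_iff.1 hpq))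
  · rintro ⟨y, hy⟩
    obtain ⟨p, hp⟩ := (digraph_adj h _ _).1 hy
    exact ⟨p, Subtype.ext hp⟩

/-- Letters are read from the end of the walk, so the word carries `y` back to `x`. The last clause
remembers the first edge of the walk, as needed to exclude cancellation. -/
theorem exists_isReduced_of_isTrail (h : FreeUpTo α X 2) {x y : X}
    (w : (digraph h).toSimpleGraph.Walk x y) (hw : w.IsTrail) :
    ∃ l : List (α × Bool), IsReduced l ∧ l.length = w.length ∧ mk l • y = x ∧
      ∀ (p : α × Bool) (l' : List (α × Bool)), l = p :: l' →
        s(x, (mk [p])⁻¹ • x) ∈ w.edges := by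
  induction w with
  | nil => exact ⟨[], FreeGroup.IsReduced.nil, rfl, one_smul _ _, by simp⟩
  | @cons x z y hadj w ih =>
    rw [SimpleGraph.Walk.isTrail_cons] at hw
    obtain ⟨l, hl, hlen, hly, hlp⟩ := ih hw.1
    obtain ⟨⟨a, b⟩, hp⟩ := (digraph_adj h _ _).1 hadj.symm
    refine ⟨(a, b) :: l, ?_, by simp [hlen], by rw [mk_cons, mul_smul, hly, hp], ?_⟩
    · cases l with
      | nil => exact FreeGroup.IsReduced.singleton
      | cons q l =>
        obtain ⟨a', b'⟩ := q
        refine FreeGroup.isReduced_cons_cons.2 ⟨fun haa => ?_, hl⟩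
        by_contra hbb
        obtain rfl : a = a' := haa
        obtain rfl : b' = !b := by cases b <;> cases b' <;> simp_all
        have := hlp _ _ rfl
        -- Cancelling letters would mean that the walk returns along the edge just used.
        rw [inv_letter, Bool.not_not, hp, Sym2.eq_swap] at this
        exact hw.2 this
    · rintro p l' hpl
      obtain rfl : (a, b) = p := (List.cons.inj hpl).1
      rw [show (mk [(a, b)])⁻¹ • x = z by rw [← hp, inv_smul_smul]]
      simp

theorem lt_egirth_digraph (h : FreeUpTo α X 2) {N : ℕ} (hN : FreeUpTo α X N) :
    (N : ℕ∞) < (digraph h).toSimpleGraph.egirth := by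
  rw [← ENat.add_one_le_iff (ENat.natCast_ne_top N), SimpleGraph.le_egirth]
  intro x w hw
  by_contra hlt
  have hlt : w.length ≤ N := by
    by_contra hle
    exact hlt (by exact_mod_cast not_le.1 hle)
  obtain ⟨l, hl, hlen, hlx, -⟩ := exists_isReduced_of_isTrail h w hw.isTrail
  have h1 := hN (mk l) (FreeGroup.norm_mk_le.trans (hlen.trans_le hlt)) x hlx
  have h2 := congrArg FreeGroup.toWord h1
  rw [FreeGroup.toWord_mk, hl.reduce_eq, FreeGroup.toWord_one] at h2
  have := hw.three_le_length
  simp [h2] at hlen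
  omega

/-- The ball of radius `r` around the identity in the Cayley graph of the free group. -/
def freeBall (α : Type) [DecidableEq α] (r : ℕ) (o : LinearOrder {g : FreeGroup α // g.norm ≤ r}) :
    RootedOrderedLDigraph α where
  Carrier := {g : FreeGroup α // g.norm ≤ r}
  order := o
  graph :=
    { Edge := fun g a h => of a * g.1 = h.1
      label_unique := fun h1 h2 =>
        FreeGroup.of_injective (mul_right_cancel (h1.trans h2.symm))
      out_proper := fun h1 h2 => Subtype.ext (h1.symm.trans h2)
      in_proper := fun h1 h2 => Subtype.ext (mul_left_cancel (h1.trans h2.symm)) }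
  root := ⟨1, by simp⟩

/-- The orbit map `g ↦ g • x` is the isomorphism. Monotonicity already makes it injective; freeness
serves to reflect edges, comparing norms `1 + r` and `r`. -/
theorem neighbourhood_digraph_isomorphic {α : Type} [DecidableEq α] {X : Type}
    [MulAction (FreeGroup α) X] [LinearOrder X] (h : FreeUpTo α X 2) {r : ℕ}
    (hr : FreeUpTo α X (2 * r + 1)) (o : LinearOrder {g : FreeGroup α // g.norm ≤ r}) (x : X)
    (hx : ∀ g g' : {g : FreeGroup α // g.norm ≤ r}, g < g' → g.1 • x < g'.1 • x) :
    ((digraph h).neighbourhood r x).Isomorphic (freeBall α r o) := by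
  let φ : {g : FreeGroup α // g.norm ≤ r} → (digraph h).ball r x :=
    fun g => ⟨g.1 • x, (mem_ball_digraph h r x _).2 ⟨g.1, g.2, rfl⟩⟩
  have hmono : StrictMono φ := fun g g' hg => hx g g' hg
  have hsurj : Function.Surjective φ := by
    rintro ⟨y, hy⟩
    obtain ⟨g, hg, hgy⟩ := (mem_ball_digraph h r x y).1 hy
    exact ⟨⟨g, hg⟩, Subtype.ext hgy⟩
  let e : {g : FreeGroup α // g.norm ≤ r} ≃o (digraph h).ball r x :=
    hmono.orderIsoOfSurjective φ hsurj
  have he : ∀ g, e g = φ g := fun g => rfl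
  refine ⟨e.symm, ?_, ?_⟩
  · change e.symm ⟨x, _⟩ = (⟨1, _⟩ : {g : FreeGroup α // g.norm ≤ r})
    rw [OrderIso.symm_apply_eq, he]
    exact Subtype.ext (one_smul _ x).symm
  · intro u v a
    obtain ⟨g, rfl⟩ := e.surjective u
    obtain ⟨g', rfl⟩ := e.surjective v
    change _ ↔ of a * (e.symm (e g)).1 = (e.symm (e g')).1
    rw [OrderIso.symm_apply_apply, OrderIso.symm_apply_apply]
    change of a • g.1 • x = g'.1 • x ↔ _
    constructor
    · intro hg
      rw [← mul_smul] at hg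
      refine hr.smul_left_cancel ?_ hg
      have := FreeGroup.norm_mul_le (of a) g.1
      have := g.2
      have := g'.2
      rw [FreeGroup.norm_of] at *
      omega
    · intro hg
      rw [← mul_smul, hg]

end Schreier

/-! ### Truncated series modulo `m` and their orders -/

namespace Magnus

/-- The nonempty words of length at most `d`. -/
def ShortWord (k d : ℕ) : Type := {w : List (Fin k) // w ≠ [] ∧ w.length ≤ d}

instance (k d : ℕ) : Finite (ShortWord k d) :=
  ((List.finite_length_le (Fin k) d).subset fun _ hw => hw.2).to_subtype

noncomputable instance (k d : ℕ) : Fintype (ShortWord k d) := Fintype.ofFinite _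

/-- Short words are ordered by length, and lexicographically for equal length. -/
instance (k d : ℕ) : LinearOrder (ShortWord k d) :=
  LinearOrder.lift' (fun w => toLex (w.1.length, w.1)) fun _ _ h =>
    Subtype.ext (congrArg (fun p => (ofLex p).2) h)

theorem ShortWord.lt_of_length_lt {k d : ℕ} {v w : ShortWord k d}
    (h : v.1.length < w.1.length) : v < w :=
  Prod.Lex.toLex_lt_toLex.2 (Or.inl h)

/-- The coefficients of `expansion g` at the short words. -/
def coeffs (k d : ℕ) (g : FreeGroup (Fin k)) : ShortWord k d → ℤ := fun w => expansion g w.1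

theorem expansion_nil {α : Type*} [DecidableEq α] (g : FreeGroup α) : expansion g [] = 1 := by
  rw [expansion, rep_apply_nil, one]

theorem expansion_eq_of_coeffs_eq {k d : ℕ} {g h : FreeGroup (Fin k)}
    (H : coeffs k d g = coeffs k d h) (w : List (Fin k)) (hw : w.length ≤ d) :
    expansion g w = expansion h w := by
  by_cases hn : w = []
  · rw [hn, expansion_nil, expansion_nil]
  · exact congrFun H ⟨w, hn, hw⟩

/-- Otherwise `h⁻¹ * g`, of norm at most `d`, would have trivial expansion up to degree `d`. -/
theorem eq_of_coeffs_eq {k d : ℕ} {g h : FreeGroup (Fin k)} (hd : g.norm + h.norm ≤ d)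
    (H : coeffs k d g = coeffs k d h) : g = h := by
  by_contra hne
  obtain ⟨w, hw, hlen, hnz⟩ := exists_expansion_ne_zero (h⁻¹ * g)
    (fun he => hne (inv_mul_eq_one.1 he).symm)
  have hlen' : w.length ≤ d := by
    have := FreeGroup.norm_mul_le h⁻¹ g
    rw [FreeGroup.norm_inv_eq] at this
    omega
  apply hnz
  rw [expansion_mul, rep_congr _ d _ _ (expansion_eq_of_coeffs_eq H) w hlen', ← expansion_mul, inv_mul_cancel,
    expansion, map_one]
  cases w with
  | nil => exact absurd rfl hw
  | cons => rfl

/-- Elements of the free group of norm at most `r`, ordered lexicographically by the coefficients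
of their expansions. -/
@[reducible] noncomputable def ballOrder (k r : ℕ) :
    LinearOrder {g : FreeGroup (Fin k) // g.norm ≤ r} :=
  LinearOrder.lift' (fun g => toLex (coeffs k (2 * r + 2) g.1)) fun g h H =>
    Subtype.ext (eq_of_coeffs_eq (by have := g.2; have := h.2; omega) (toLex.injective H))

/-- Truncated power series over `ZMod m` with constant term `1`. -/
def Series (k d m : ℕ) : Type := ShortWord k d → ZMod m

noncomputable instance (k d m : ℕ) [NeZero m] : Fintype (Series k d m) :=
  inferInstanceAs (Fintype (ShortWord k d → ZMod m))

instance (k d m : ℕ) : Nonempty (Series k d m) := ⟨fun _ => 0⟩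

/-- The power series of a truncated power series. -/
def Series.extend {k d m : ℕ} (f : Series k d m) (w : List (Fin k)) : ZMod m :=
  if h : w ≠ [] ∧ w.length ≤ d then f ⟨w, h⟩ else if w = [] then 1 else 0

/-- Truncation of a power series. -/
def truncate {k d m : ℕ} (f : List (Fin k) → ZMod m) : Series k d m := fun w => f w.1

theorem Series.extend_nil {k d m : ℕ} (f : Series k d m) : f.extend [] = 1 := by
  simp [Series.extend]

theorem truncate_extend {k d m : ℕ} (f : Series k d m) : truncate f.extend = f := by
  funext w
  exact dif_pos w.2

theorem extend_truncate {k d m : ℕ} (f : List (Fin k) → ZMod m) (hf : f [] = 1)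
    (w : List (Fin k)) (hw : w.length ≤ d) : (truncate f : Series k d m).extend w = f w := by
  by_cases hn : w = []
  · rw [hn, Series.extend_nil, hf]
  · exact dif_pos ⟨hn, hw⟩

/-- By `rep_congr`, the values that `Series.extend` assigns beyond degree `d` are immaterial. -/
instance (k d m : ℕ) : MulAction (FreeGroup (Fin k)) (Series k d m) where
  smul g f := truncate (rep (ZMod m) g f.extend)
  one_smul f := by
    change truncate (rep (ZMod m) 1 f.extend) = f
    rw [map_one]
    exact truncate_extend f
  mul_smul g h f := by
    change truncate (rep (ZMod m) (g * h) f.extend) =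
      truncate (rep (ZMod m) g (truncate (rep (ZMod m) h f.extend) : Series k d m).extend)
    funext w
    rw [map_mul, Equiv.Perm.mul_apply]
    refine (rep_congr g d _ _ (fun v hv => ?_) w.1 w.2.2).symm
    exact extend_truncate _ (by rw [rep_apply_nil, Series.extend_nil]) v hv

theorem smul_sub_smul {k d m : ℕ} {g h : FreeGroup (Fin k)} (f : Series k d m)
    (w : ShortWord k d) (H : ∀ v < w, coeffs k d g v = coeffs k d h v) :
    (g • f) w - (h • f) w = ((coeffs k d g w - coeffs k d h w : ℤ) : ZMod m) := by
  have := rep_sub_rep g h f.extend w.1 (fun v hv => ?_)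
  · rw [Series.extend_nil, mul_one] at this
    exact this
  · by_cases hn : v = []
    · rw [hn, expansion_nil, expansion_nil]
    · exact H ⟨v, hn, hv.le.trans w.2.2⟩ (ShortWord.lt_of_length_lt hv)

noncomputable instance (k d m : ℕ) [NeZero m] : LinearOrder (Series k d m) :=
  LinearOrder.lift' (fun f => toLex fun w => (f w).val) fun _ _ H =>
    funext fun w => ZMod.val_injective m (congrFun (toLex.injective H) w)

theorem finite_norm_le (k d : ℕ) : {g : FreeGroup (Fin k) | g.norm ≤ d}.Finite :=
  Set.Finite.of_finite_image ((List.finite_length_le (Fin k × Bool) d).subset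
    (by rintro _ ⟨g, hg, rfl⟩; exact hg)) FreeGroup.toWord_injective.injOn

theorem exists_coeffs_sub_bound (k d : ℕ) :
    ∃ B : ℕ, ∀ g h : FreeGroup (Fin k), g.norm ≤ d → h.norm ≤ d → ∀ w : ShortWord k d,
      (coeffs k d g w - coeffs k d h w).natAbs ≤ B := by
  have hfin := (((finite_norm_le k d).prod (finite_norm_le k d)).prod
    (Set.finite_univ (α := ShortWord k d))).image
      (fun p => (coeffs k d p.1.1 p.2 - coeffs k d p.1.2 p.2).natAbs)
  obtain ⟨B, hB⟩ := hfin.bddAbove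
  exact ⟨B, fun g h hg hh w => hB ⟨((g, h), w), ⟨⟨hg, hh⟩, trivial⟩, rfl⟩⟩

theorem freeUpTo_series {k d m B : ℕ}
    (hB : ∀ g h : FreeGroup (Fin k), g.norm ≤ d → h.norm ≤ d → ∀ w : ShortWord k d,
      (coeffs k d g w - coeffs k d h w).natAbs ≤ B) (hm : B < m) :
    Schreier.FreeUpTo (Fin k) (Series k d m) d := by
  intro g hg f hf
  by_contra hne
  have hc : coeffs k d g ≠ coeffs k d 1 :=
    fun h => hne (eq_of_coeffs_eq (by simpa using hg) h)
  obtain ⟨w, hw, hmin⟩ := WellFounded.has_min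
    (wellFounded_lt (α := ShortWord k d)) {w | coeffs k d g w ≠ coeffs k d 1 w}
    (Function.ne_iff.1 hc)
  -- At the first differing word, a fixed point forces `m` to divide a nonzero integer of absolute
  -- value at most `B < m`.
  have h1 := smul_sub_smul (m := m) f w (fun v hv => not_not.1 fun h => hmin v h hv)
  rw [hf, one_smul, sub_self, eq_comm, ZMod.intCast_zmod_eq_zero_iff_dvd,
    Int.natCast_dvd] at h1
  have h2 := hB g 1 hg (by simp) w
  have h3 := Nat.le_of_dvd (by have : coeffs k d g w ≠ coeffs k d 1 w := hw; omega) h1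
  omega

theorem smul_lt_smul_of_val_add_lt {k r m B : ℕ} [NeZero m]
    (hB : ∀ g h : FreeGroup (Fin k), g.norm ≤ 2 * r + 2 → h.norm ≤ 2 * r + 2 →
      ∀ w : ShortWord k (2 * r + 2),
        (coeffs k (2 * r + 2) g w - coeffs k (2 * r + 2) h w).natAbs ≤ B)
    (f : Series k (2 * r + 2) m)
    (hf : ∀ g : FreeGroup (Fin k), g.norm ≤ r → ∀ w, ((g • f) w).val + B < m)
    (g h : {g : FreeGroup (Fin k) // g.norm ≤ r})
    (hgh : (ballOrder k r).lt g h) : g.1 • f < h.1 • f := by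
  obtain ⟨w, hw, hlt⟩ : ∃ w, (∀ v < w, coeffs k (2 * r + 2) g.1 v = coeffs k (2 * r + 2) h.1 v) ∧
    coeffs k (2 * r + 2) g.1 w < coeffs k (2 * r + 2) h.1 w := hgh
  refine (⟨w, fun v hv => ?_, ?_⟩ : ∃ w : ShortWord k (2 * r + 2),
    (∀ v < w, ((g.1 • f) v).val = ((h.1 • f) v).val) ∧ ((g.1 • f) w).val < ((h.1 • f) w).val)
  · have := smul_sub_smul f v (fun u hu => hw u (hu.trans hv))
    rw [hw v hv, sub_self, Int.cast_zero, sub_eq_zero] at this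
    rw [this]
  · have h1 := smul_sub_smul f w (fun u hu => (hw u hu).symm)
    have h2 := hB h.1 g.1 (by have := h.2; omega) (by have := g.2; omega) w
    obtain ⟨n, hn⟩ := Int.eq_ofNat_of_zero_le (sub_nonneg.2 hlt.le)
    rw [hn] at h1 h2
    -- Since `n ≤ B`, the sum stays below `m` and no reduction occurs.
    have h3 : (h.1 • f) w = ((((g.1 • f) w).val + n : ℕ) : ZMod m) := by
      rw [sub_eq_iff_eq_add.1 h1]
      push_cast
      rw [ZMod.natCast_zmod_val]
      ring
    have h4 := hf g.1 g.2 w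
    rw [h3, ZMod.val_natCast_of_lt (by simp at h2; omega)]
    omega

/-! ### Counting bad series and choosing an orbit -/

theorem card_filter_val_le (m B : ℕ) [NeZero m] :
    (Finset.univ.filter fun c : ZMod m => m ≤ c.val + B).card ≤ B := by
  rw [← Finset.card_image_of_injective _ (ZMod.val_injective m)]
  refine (Finset.card_le_card (t := Finset.Ico (m - B) m) fun c hc => ?_).trans ?_
  · obtain ⟨a, ha, rfl⟩ := Finset.mem_image.1 hc
    have h1 := (Finset.mem_filter.1 ha).2
    have h2 := ZMod.val_lt a
    rw [Finset.mem_Ico]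
    omega
  · rw [Nat.card_Ico]; omega

theorem card_mul_card_filter_apply {ι β : Type*} [Fintype ι] [DecidableEq ι] [Fintype β]
    (i : ι) (P : β → Prop) [DecidablePred P] :
    Fintype.card β * (Finset.univ.filter fun f : ι → β => P (f i)).card =
      (Finset.univ.filter P).card * Fintype.card (ι → β) := by
  have h1 : (Finset.univ.filter fun f : ι → β => P (f i)) =
      Fintype.piFinset fun j => if j = i then Finset.univ.filter P else Finset.univ := by
    ext f
    rw [Finset.mem_filter, Fintype.mem_piFinset]
    constructor
    · intro h j
      by_cases hj : j = i
      · subst hj; simpa using h.2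
      · simp [hj]
    · intro h
      simpa using h i
  rw [h1, Fintype.card_piFinset, Fintype.card_pi, ← Finset.mul_prod_erase _ _ (Finset.mem_univ i),
    ← Finset.mul_prod_erase _ (fun _ => Fintype.card β) (Finset.mem_univ i), if_pos rfl,
    Finset.prod_congr rfl (g := fun _ => Fintype.card β) fun j hj => by
      rw [if_neg (Finset.ne_of_mem_erase hj), Finset.card_univ]]
  ring

-- Union bound over group elements and words: `g` permutes the series, so each coefficient of `g •
-- f` is as rarely bad as one of `f`.
open Classical in
theorem card_filter_not_forall_val_add_lt (k d r m B : ℕ) [NeZero m] :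
    m * (Finset.univ.filter fun f : Series k d m =>
      ¬ ∀ g : FreeGroup (Fin k), g.norm ≤ r → ∀ w, ((g • f) w).val + B < m).card ≤
      (finite_norm_le k r).toFinset.card * Fintype.card (ShortWord k d) * B *
        Fintype.card (Series k d m) := by
  have hone : ∀ (g : FreeGroup (Fin k)) (w : ShortWord k d),
      m * (Finset.univ.filter fun f : Series k d m => m ≤ ((g • f) w).val + B).card ≤
        B * Fintype.card (Series k d m) := by
    intro g w
    have h1 : (Finset.univ.filter fun f : Series k d m => m ≤ ((g • f) w).val + B).card ≤
        (Finset.univ.filter fun f : Series k d m => m ≤ (f w).val + B).card :=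
      Finset.card_le_card_of_injOn (fun f => g • f) (fun f hf => by simpa using hf)
        (MulAction.injective g).injOn
    have h2 := card_mul_card_filter_apply w (fun c : ZMod m => m ≤ c.val + B)
    rw [ZMod.card] at h2
    calc _ ≤ m * (Finset.univ.filter fun f : Series k d m => m ≤ (f w).val + B).card :=
          Nat.mul_le_mul_left m h1
      _ = _ := h2
      _ ≤ _ := Nat.mul_le_mul_right _ (card_filter_val_le m B)
  have hsub : (Finset.univ.filter fun f : Series k d m =>
      ¬ ∀ g : FreeGroup (Fin k), g.norm ≤ r → ∀ w, ((g • f) w).val + B < m) ⊆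
      ((finite_norm_le k r).toFinset ×ˢ (Finset.univ : Finset (ShortWord k d))).biUnion
        fun p => Finset.univ.filter fun f : Series k d m => m ≤ ((p.1 • f) p.2).val + B := by
    intro f hf
    simp only [Finset.mem_filter, Finset.mem_univ, true_and, not_forall, not_lt] at hf
    obtain ⟨g, hg, w, hw⟩ := hf
    simp only [Finset.mem_biUnion, Finset.mem_filter, Finset.mem_univ, true_and]
    exact ⟨(g, w), by simpa using hg, hw⟩
  calc _ ≤ m * ∑ p ∈ (finite_norm_le k r).toFinset ×ˢ (Finset.univ : Finset (ShortWord k d)),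
        (Finset.univ.filter fun f : Series k d m => m ≤ ((p.1 • f) p.2).val + B).card :=
        Nat.mul_le_mul_left m ((Finset.card_le_card hsub).trans Finset.card_biUnion_le)
    _ = ∑ p ∈ (finite_norm_le k r).toFinset ×ˢ (Finset.univ : Finset (ShortWord k d)),
        m * (Finset.univ.filter fun f : Series k d m => m ≤ ((p.1 • f) p.2).val + B).card :=
        Finset.mul_sum _ _ _
    _ ≤ ∑ p ∈ (finite_norm_le k r).toFinset ×ˢ (Finset.univ : Finset (ShortWord k d)),
        B * Fintype.card (Series k d m) := Finset.sum_le_sum fun p _ => hone p.1 p.2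
    _ = _ := by
      rw [Finset.sum_const, Finset.card_product, Finset.card_univ, smul_eq_mul, mul_assoc _ B]

-- Averaging: if every fibre exceeded the proportion `ε`, so would the whole set.
open Classical in
theorem exists_fiber_card_filter_le {V Q : Type*} [Fintype V] [Nonempty V] (π : V → Q)
    (P : V → Prop) (ε : ℝ)
    (h : ((Finset.univ.filter P).card : ℝ) ≤ ε * Fintype.card V) :
    ∃ x : V, ((Finset.univ.filter fun y => π y = π x ∧ P y).card : ℝ) ≤
      ε * (Finset.univ.filter fun y => π y = π x).card := by
  by_contra! hlt
  have h1 : ∑ q ∈ Finset.univ.image π, ε * ((Finset.univ.filter fun y => π y = q).card : ℝ) <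
      ∑ q ∈ Finset.univ.image π, ((Finset.univ.filter fun y => π y = q ∧ P y).card : ℝ) := by
    refine Finset.sum_lt_sum_of_nonempty (Finset.univ_nonempty.image π) fun q hq => ?_
    obtain ⟨x, -, rfl⟩ := Finset.mem_image.1 hq
    exact hlt x
  rw [← Finset.mul_sum, ← Nat.cast_sum, ← Nat.cast_sum,
    ← Finset.card_eq_sum_card_fiberwise (s := Finset.univ)
      (fun x _ => Finset.mem_coe.2 (Finset.mem_image_of_mem π (Finset.mem_univ x)))] at h1
  have h2 := Finset.card_eq_sum_card_fiberwise (f := π) (s := Finset.univ.filter P)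
    (t := Finset.univ.image π)
    (fun x _ => Finset.mem_coe.2 (Finset.mem_image_of_mem π (Finset.mem_univ x)))
  simp only [Finset.filter_filter] at h2
  simp only [and_comm (b := P _)] at h1
  rw [← h2, Finset.card_univ] at h1
  exact absurd h (not_le.2 h1)

open Classical in
theorem exists_orbit_card_le {G V : Type*} [Group G] [MulAction G V] [Fintype V] [Nonempty V]
    (P : V → Prop) (ε : ℝ)
    (h : ((Finset.univ.filter fun x => ¬ P x).card : ℝ) ≤ ε * Fintype.card V) :
    ∃ x : V, (1 - ε) * (Fintype.card (MulAction.orbit G x) : ℝ) ≤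
      ((Finset.univ.filter fun y : MulAction.orbit G x => P y.1).card : ℝ) := by
  obtain ⟨x, hx⟩ := exists_fiber_card_filter_le
    (fun y : V => (Quotient.mk (MulAction.orbitRel G V) y)) (fun y => ¬ P y) ε (by convert h)
  refine ⟨x, ?_⟩
  have hmem : ∀ y, Quotient.mk (MulAction.orbitRel G V) y = Quotient.mk (MulAction.orbitRel G V) x ↔
      y ∈ MulAction.orbit G x := fun y => by
    rw [Quotient.eq, MulAction.orbitRel_apply]
  simp only [hmem] at hx
  have h1 : (Finset.univ.filter fun y => y ∈ MulAction.orbit G x).card =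
      Fintype.card (MulAction.orbit G x) := (Fintype.card_subtype _).symm
  have h2 : (Finset.univ.filter fun y => y ∈ MulAction.orbit G x ∧ ¬ P y).card =
      (Finset.univ.filter fun y : MulAction.orbit G x => ¬ P y.1).card := by
    rw [← Finset.card_map (Function.Embedding.subtype _)]
    congr 1
    ext y
    simp [and_comm]
  rw [h1, h2] at hx
  have h3 := Finset.card_filter_add_card_filter_not (s := Finset.univ)
    (fun y : MulAction.orbit G x => P y.1)
  rw [Finset.card_univ] at h3
  have h4 := congrArg (Nat.cast (R := ℝ)) h3
  push_cast at h4
  linarith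

end Magnus

/-! ### Assembly -/

theorem theorem3 (k r : ℕ) :
    ∃ τ : RootedOrderedLDigraph (Fin k),
      ∀ ε : ℝ, 0 < ε →
        ∃ (V : Type) (_ : Fintype V) (_ : LinearOrder V) (H : LDigraph (Fin k) V)
          (_ : H.toSimpleGraph.LocallyFinite),
          H.toSimpleGraph.Connected ∧
          H.toSimpleGraph.IsRegularOfDegree (2 * k) ∧
          ((2 * r + 1 : ℕ) : ℕ∞) < H.toSimpleGraph.egirth ∧
          H.IsHomogeneous (1 - ε) r τ := by
  classical
  refine ⟨Schreier.freeBall (Fin k) r (Magnus.ballOrder k r), fun ε hε => ?_⟩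
  obtain ⟨B, hB⟩ := Magnus.exists_coeffs_sub_bound k (2 * r + 2)
  set K := (Magnus.finite_norm_le k r).toFinset.card *
    Fintype.card (Magnus.ShortWord k (2 * r + 2)) * B with hK
  -- The first bound gives freeness, the second makes the bad proportion `K / m` at most `ε`.
  obtain ⟨m, hm⟩ := exists_nat_ge (max ((B : ℝ) + 1) (K / ε))
  have hBm : B < m := by exact_mod_cast (le_max_left _ _).trans hm
  have hKm : (K : ℝ) ≤ ε * m := by
    rw [mul_comm]
    exact (div_le_iff₀ hε).1 ((le_max_right _ _).trans hm)
  have : NeZero m := ⟨by omega⟩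
  have hm0 : (0 : ℝ) < m := by exact_mod_cast Nat.pos_of_ne_zero (NeZero.ne m)
  have hcard := Magnus.card_filter_not_forall_val_add_lt k (2 * r + 2) r m B
  rw [← hK] at hcard
  have hcard' := (Nat.cast_le (α := ℝ)).2 hcard
  push_cast at hcard'
  obtain ⟨x, hx⟩ := Magnus.exists_orbit_card_le (G := FreeGroup (Fin k))
    (fun f : Magnus.Series k (2 * r + 2) m =>
      ∀ g : FreeGroup (Fin k), g.norm ≤ r → ∀ w, ((g • f) w).val + B < m) ε (by
    refine le_of_mul_le_mul_left (hcard'.trans ?_) hm0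
    rw [← mul_assoc, mul_comm (m : ℝ)]
    exact mul_le_mul_of_nonneg_right hKm (Nat.cast_nonneg _))
  have hfree := Magnus.freeUpTo_series hB hBm
  have hfreeX : Schreier.FreeUpTo (Fin k)
      (MulAction.orbit (FreeGroup (Fin k)) x) (2 * r + 2) :=
    fun g hg y hy => hfree g hg y.1 (Subtype.ext_iff.1 hy)
  have : Nonempty (MulAction.orbit (FreeGroup (Fin k)) x) := ⟨⟨x, MulAction.mem_orbit_self x⟩⟩
  -- Degree `2r+2` rather than `2r+1` ensures freeness up to norm `2` even for `r = 0`.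
  have h2 := hfreeX.mono (show 2 ≤ 2 * r + 2 by omega)
  have h2r := hfreeX.mono (show 2 * r + 1 ≤ 2 * r + 2 by omega)
  refine ⟨MulAction.orbit (FreeGroup (Fin k)) x, inferInstance, inferInstance,
    Schreier.digraph h2, fun _ => Fintype.ofFinite _, Schreier.digraph_connected h2, fun y => ?_,
    Schreier.lt_egirth_digraph h2 h2r,
    Finset.univ.filter fun y => ∀ g : FreeGroup (Fin k), g.norm ≤ r →
      ∀ w, ((g • y.1) w).val + B < m, ?_, fun y hy => ?_⟩
  · have hdeg : ∀ _ : Fintype ((Schreier.digraph h2).toSimpleGraph.neighborSet y),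
        (Schreier.digraph h2).toSimpleGraph.degree y = 2 * k := fun _ => by
      rw [← SimpleGraph.card_neighborSet_eq_degree, ← Nat.card_eq_fintype_card,
        Schreier.card_neighborSet_digraph h2, Nat.card_prod]
      simp [mul_comm]
    exact hdeg _
  · convert hx
  · exact Schreier.neighbourhood_digraph_isomorphic h2 h2r _ y fun g g' hg =>
      Magnus.smul_lt_smul_of_val_add_lt hB y.1 (Finset.mem_filter.1 hy).2 g g' hg
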